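/- For a permutation $\sigma$ of $[n]=\{1,\dots,n\}$, let $G_\sigma$ be the unlabeled graph (that is, the graph considered up to isomorphism) underlying the graph with vertex set $[n]$ in which $i$ and $j$ are adjacent if and only if $(\sigma(i)-\sigma(j))(i-j)<0$; it is called the inversion graph of $\sigma$. A graph $G$ is a permutation graph if $G=G_\sigma$ for some permutation $\sigma$. A module of a graph $G$ with vertex set $V_G$ is a set $M\subseteq V_G$ such that, for all $m,m'\in M$ and all $u\in V_G\setminus M$, either both $\{m,u\}$ and $\{m',u\}$ are edges of $G$ or none of them is. The graph $G$ is modular-prime if it has no modules other than $\emptyset$, $V_G$ and the singletons $\{v\}$, $v\in V_G$. An interval of a permutation $\sigma$ of $[n]$ is a (possibly empty) set $I\subseteq[n]$ of contiguous integers whose image $\sigma(I)$ is also a set of contiguous integers. The permutation $\sigma$ is simple if it has no intervals other than $\emptyset$, $[n]$ and the singletons $\{i\}$, $i\in[n]$. **Proposition.** Let $G$ be a modular-prime permutation graph. Then there are at most $4$ permutations $\tau$ (of any size) such that $G=G_\tau$, and every such permutation $\tau$ is simple. -/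

import Mathlib

/-- The labelled inversion graph of a permutation `σ` of size `n` (indices `0, …, n - 1`):
`i` and `j` are joined iff `(σ(i) - σ(j)) (i - j) < 0`. -/
def inversionGraph {n : ℕ} (σ : Equiv.Perm (Fin n)) : SimpleGraph (Fin n) where
  Adj i j := (((σ i : ℕ) : ℤ) - ((σ j : ℕ) : ℤ)) * (((i : ℕ) : ℤ) - ((j : ℕ) : ℤ)) < 0
  symm := ⟨fun i j h => by linarith⟩
  loopless := ⟨fun i h => by simp at h⟩

/-- `σ` is a realizer of `G`: `G` equals the inversion graph of `σ` as an unlabelled graph,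
that is, up to graph isomorphism. -/
def Realizes {V : Type*} {n : ℕ} (σ : Equiv.Perm (Fin n)) (G : SimpleGraph V) : Prop :=
  Nonempty (G ≃g inversionGraph σ)

/-- A permutation graph is a graph which has a realizer. -/
def IsPermutationGraph {V : Type*} (G : SimpleGraph V) : Prop :=
  ∃ (n : ℕ) (σ : Equiv.Perm (Fin n)), Realizes σ G

/-- A module of `G`: any vertex outside of `M` is adjacent to all or to none of the elements
of `M`. -/
def IsGraphModule {V : Type*} (G : SimpleGraph V) (M : Set V) : Prop :=
  ∀ m ∈ M, ∀ m' ∈ M, ∀ u, u ∉ M → (G.Adj m u ↔ G.Adj m' u)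

/-- `G` has no modules other than `∅`, the whole vertex set and the singletons. -/
def IsModularPrime {V : Type*} (G : SimpleGraph V) : Prop :=
  ∀ M : Set V, IsGraphModule G M → M = ∅ ∨ M = Set.univ ∨ ∃ v, M = {v}

/-- An interval of `σ`: a set of contiguous indices (the empty set is allowed) whose image by `σ`
is also contiguous. In `Fin n`, contiguous means order-connected. -/
def IsPermInterval {n : ℕ} (σ : Equiv.Perm (Fin n)) (I : Set (Fin n)) : Prop :=
  I.OrdConnected ∧ (σ '' I).OrdConnected

/-- `σ` has no intervals other than `∅`, the whole index set and the singletons. -/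
def IsSimplePerm {n : ℕ} (σ : Equiv.Perm (Fin n)) : Prop :=
  ∀ I : Set (Fin n), IsPermInterval σ I → I = ∅ ∨ I = Set.univ ∨ ∃ i, I = {i}

/-! A realizer is determined by the left-to-right order of the vertices. On edges of `G` this order
is a forced orientation of `G`, on non-edges one of `Gᶜ`. If each is unique up to reversal, two bits
encode a realizer, whence the bound 4. For uniqueness (`IsModularPrime.orientation_unique`), colour
each pair of vertices by whether it is a non-edge, or an edge where two orientations agree or
disagree. No triangle is rainbow, so a monochromatic component is seen in one colour from each
outside vertex and is a module; by primality every colour that occurs is connected. Gallai's theorem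
forbids this for all three colours at once. Simplicity holds because intervals are modules. -/

/-! ### Gallai's theorem on rainbow-free 3-colourings. -/

/-- One step along an edge of colour `c` inside `T`. -/
def ColorStep {V : Type*} (col : V → V → Fin 3) (T : Finset V) (c : Fin 3) (a b : V) : Prop :=
  a ∈ T ∧ b ∈ T ∧ col a b = c

/-- Reachability inside `T` along edges of colour `c`. -/
abbrev ColorReach {V : Type*} (col : V → V → Fin 3) (T : Finset V) (c : Fin 3) : V → V → Prop :=
  Relation.ReflTransGen (ColorStep col T c)

/-- A colouring of the edges of a complete graph without rainbow triangles. -/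
def RainbowFree {V : Type*} (col : V → V → Fin 3) : Prop :=
  ∀ x y z, x ≠ y → y ≠ z → x ≠ z →
    col x y = col y z ∨ col y z = col x z ∨ col x y = col x z

theorem ColorReach.symm {V : Type*} {col : V → V → Fin 3} (hs : ∀ x y, col x y = col y x)
    {T : Finset V} {c : Fin 3} {x y : V} (h : ColorReach col T c x y) :
    ColorReach col T c y x := by
  induction h with
  | refl => exact .refl
  | tail _ h ih => exact .head ⟨h.2.1, h.1, (hs _ _).trans h.2.2⟩ ih

/-- A vertex outside of a monochromatic component sees it in a single colour. -/
theorem ColorReach.col_eq {V : Type*} {col : V → V → Fin 3} (hs : ∀ x y, col x y = col y x)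
    (hr : RainbowFree col) {T : Finset V} {c : Fin 3} {u x y : V} (hy : y ∈ T)
    (hyu : ¬ ColorReach col T c u y) (h : ColorReach col T c u x) : col y u = col y x := by
  induction h with
  | refl => rfl
  | @tail a b hua hab ih =>
    have hub : ColorReach col T c u b := hua.tail hab
    rw [ih]
    have hya : y ≠ a := by rintro rfl; exact hyu hua
    have hyb : y ≠ b := by rintro rfl; exact hyu hub
    by_cases e : a = b
    · rw [e]
    have h1 : col y a ≠ c := fun e => hyu (hua.tail ⟨hab.1, hy, (hs _ _).trans e⟩)
    have h2 : col y b ≠ c := fun e => hyu (hub.tail ⟨hab.2.1, hy, (hs _ _).trans e⟩)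
    have h3 := hab.2.2
    rcases hr y a b hya e hyb with h | h | h
    · exact absurd (h.trans h3) h1
    · exact absurd (h.symm.trans h3) h2
    · exact h

theorem ColorReach.eq_or_mem {V : Type*} {col : V → V → Fin 3} {T : Finset V} {c : Fin 3}
    {x y : V} (h : ColorReach col T c x y) : x = y ∨ y ∈ T := by
  cases h with
  | refl => exact .inl rfl
  | tail _ h => exact .inr h.2.1

/-- A path ending in `v` reaches a neighbour of `v` before meeting `v`. -/
theorem ColorReach.exists_erase {V : Type*} [DecidableEq V] {col : V → V → Fin 3}
    {S : Finset V} {c : Fin 3} {t v : V} (htv : t ≠ v) (h : ColorReach col S c t v) :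
    ∃ a, ColorReach col (S.erase v) c t a ∧ col a v = c := by
  have key : ∀ x, ColorReach col S c t x →
      ColorReach col (S.erase v) c t x ∨ ∃ a, ColorReach col (S.erase v) c t a ∧ col a v = c := by
    intro x hx
    induction hx with
    | refl => exact .inl .refl
    | @tail a b _ hab ih =>
      rcases ih with ih | ih
      · by_cases hb : b = v
        · subst hb
          exact .inr ⟨a, ih, hab.2.2⟩
        · by_cases ha : a = v
          · subst ha
            rcases ih.eq_or_mem with e | e
            · exact absurd e htv
            · simp at e
          · exact .inl (ih.tail ⟨Finset.mem_erase.2 ⟨ha, hab.1⟩,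
              Finset.mem_erase.2 ⟨hb, hab.2.1⟩, hab.2.2⟩)
      · exact .inr ih
  rcases key v h with h | h
  · rcases h.eq_or_mem with e | e
    · exact absurd e htv
    · simp at e
  · exact h

theorem exists_other_colors (c : Fin 3) :
    ∃ p q : Fin 3, p ≠ c ∧ q ≠ c ∧ p ≠ q ∧ ∀ r, r = c ∨ r = p ∨ r = q := by
  revert c; decide

/-- Gallai: in a colouring without rainbow triangles, some colour is not connected. -/
theorem RainbowFree.exists_not_connected {V : Type*} [DecidableEq V] {col : V → V → Fin 3}
    (hs : ∀ x y, col x y = col y x) (hr : RainbowFree col) (S : Finset V) (hS : 2 ≤ S.card) :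
    ∃ c, ∃ x ∈ S, ∃ y ∈ S, ¬ ColorReach col S c x y := by
  induction S using Finset.strongInduction with
  | H S ih =>
  by_contra! hcon
  obtain ⟨v, hv⟩ : S.Nonempty := Finset.card_pos.1 (by omega)
  have hcard := Finset.card_erase_of_mem hv
  obtain ⟨t₀, ht₀⟩ : (S.erase v).Nonempty := Finset.card_pos.1 (by omega)
  have hA : ∀ c, ∀ t ∈ S.erase v, ∃ a ∈ S.erase v, ColorReach col (S.erase v) c t a ∧
      col a v = c := by
    intro c t ht
    have h := Finset.mem_erase.1 ht
    obtain ⟨a, h1, h2⟩ := (hcon c t h.2 v hv).exists_erase h.1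
    refine ⟨a, ?_, h1, h2⟩
    rcases h1.eq_or_mem with e | e
    · exact e ▸ ht
    · exact e
  by_cases h2 : 2 ≤ (S.erase v).card
  · obtain ⟨c, x, hx, y, hy, hxy⟩ := ih _ (Finset.erase_ssubset hv) h2
    obtain ⟨p, q, hp, hq, hpq, hall⟩ := exists_other_colors c
    obtain ⟨u, hu, -, huv⟩ := hA p t₀ ht₀
    obtain ⟨w, hw, -, hwv⟩ := hA q t₀ ht₀
    -- The `c`-component of `t` contains some `a` with `av` of colour `c`. In the triangle `u, a,
    -- v`, `uv` has colour `r ≠ c` and `ua` is not `c`, so `ua` has colour `r`; and `u` sees the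
    -- whole component in one colour.
    have key : ∀ r, r ≠ c → ∀ u ∈ S.erase v, col u v = r → ∀ t ∈ S.erase v,
        ¬ ColorReach col (S.erase v) c u t → col u t = r := by
      intro r hrc u hu huv t ht hut
      obtain ⟨a, ha, hta, hav⟩ := hA c t ht
      have htu : ¬ ColorReach col (S.erase v) c t u := fun h => hut (h.symm hs)
      rw [hta.col_eq hs hr hu htu]
      have hua : ¬ ColorReach col (S.erase v) c u a := fun h => hut (h.trans (hta.symm hs))
      have hne : u ≠ a := by rintro rfl; exact hua .refl
      have hc : col u a ≠ c := fun e => hua (.single ⟨hu, ha, e⟩)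
      rcases hr u a v hne (Finset.ne_of_mem_erase ha) (Finset.ne_of_mem_erase hu) with e | e | e
      · exact absurd (e.trans hav) hc
      · exact absurd (huv.symm.trans (e.symm.trans hav)) hrc
      · exact e.trans huv
    -- Same component: an outside `t` sees `u` and `w` alike, yet in colours `p` and `q`. Different
    -- components: the edge `uw` has both colours.
    by_cases huw : ColorReach col (S.erase v) c u w
    · obtain ⟨t, ht, hut⟩ : ∃ t ∈ S.erase v, ¬ ColorReach col (S.erase v) c u t := by
        by_contra! h
        exact hxy (((h x hx).symm hs).trans (h y hy))
      have hwt : ¬ ColorReach col (S.erase v) c w t := fun h => hut (huw.trans h)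
      have e := huw.col_eq hs hr ht hut
      rw [hs t u, hs t w, key p hp u hu huv t ht hut, key q hq w hw hwv t ht hwt] at e
      exact hpq e
    · have e1 := key p hp u hu huv w hw huw
      have e2 := key q hq w hw hwv u hu fun h => huw (h.symm hs)
      exact hpq (e1.symm.trans ((hs u w).trans e2))
  · have h1 : (S.erase v).card ≤ 1 := by omega
    obtain ⟨a, ha, -, hav⟩ := hA 0 t₀ ht₀
    obtain ⟨b, hb, -, hbv⟩ := hA 1 t₀ ht₀
    have := Finset.card_le_one.1 h1 a ha b hb
    subst this
    exact absurd (hav.symm.trans hbv) (by decide)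

/-! ### Forced orientations and their uniqueness. -/

/-- A choice of direction for each edge such that two edges at a common vertex whose other ends
are not adjacent are both directed towards or both away from the common vertex. -/
structure IsForcedOrientation {V : Type*} (G : SimpleGraph V) (r : V → V → Prop) : Prop where
  asymm : ∀ u v, u ≠ v → (r u v ↔ ¬ r v u)
  forced : ∀ a b c, G.Adj a b → G.Adj a c → b ≠ c → ¬ G.Adj b c → (r a b ↔ r a c)

open Classical in
/-- The colouring recording non-adjacency, agreement and disagreement of two orientations. -/
noncomputable def comparisonColor {V : Type*} (G : SimpleGraph V) (r s : V → V → Prop)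
    (u v : V) : Fin 3 :=
  if G.Adj u v then (if (r u v ↔ s u v) then 0 else 1) else 2

section comparison

variable {V : Type*} {G : SimpleGraph V} {r s : V → V → Prop}

theorem comparisonColor_eq_two {u v : V} : comparisonColor G r s u v = 2 ↔ ¬ G.Adj u v := by
  unfold comparisonColor; split_ifs <;> simp_all

theorem comparisonColor_eq_zero {u v : V} :
    comparisonColor G r s u v = 0 ↔ G.Adj u v ∧ (r u v ↔ s u v) := by
  unfold comparisonColor; split_ifs <;> simp_all

theorem comparisonColor_eq_one {u v : V} :
    comparisonColor G r s u v = 1 ↔ G.Adj u v ∧ ¬ (r u v ↔ s u v) := by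
  unfold comparisonColor; split_ifs <;> simp_all

theorem comparisonColor_comm (hr : IsForcedOrientation G r) (hs : IsForcedOrientation G s)
    (u v : V) : comparisonColor G r s u v = comparisonColor G r s v u := by
  rcases eq_or_ne u v with rfl | h
  · rfl
  have h1 := hr.asymm u v h
  have h2 := hs.asymm u v h
  have h3 : (r u v ↔ s u v) ↔ (r v u ↔ s v u) := by tauto
  unfold comparisonColor
  classical
  exact if_congr (G.adj_comm u v) (if_congr h3 rfl rfl) rfl

theorem comparisonColor_eq_of_not_adj (hr : IsForcedOrientation G r)
    (hs : IsForcedOrientation G s) {a b c : V} (hab : G.Adj a b) (hac : G.Adj a c) (hbc : b ≠ c)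
    (h : ¬ G.Adj b c) : comparisonColor G r s a b = comparisonColor G r s a c := by
  unfold comparisonColor
  rw [if_pos hab, if_pos hac]
  classical
  exact if_congr (iff_congr (hr.forced a b c hab hac hbc h) (hs.forced a b c hab hac hbc h)) rfl rfl

/-- A rainbow triangle would have exactly one non-edge, but then forcing gives its two edges the
same colour. -/
theorem rainbowFree_comparisonColor (hr : IsForcedOrientation G r)
    (hs : IsForcedOrientation G s) : RainbowFree (comparisonColor G r s) := by
  intro x y z hxy hyz hxz
  have two : ∀ {p q}, p ≠ q → p ≠ 2 → q ≠ (2 : Fin 3) → ∀ {t : Fin 3}, t ≠ 2 → t = p ∨ t = q := by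
    decide
  have cm := comparisonColor_comm hr hs
  by_cases h1 : G.Adj x y <;> by_cases h2 : G.Adj y z <;> by_cases h3 : G.Adj x z
  · have e1 := (comparisonColor_eq_two (r := r) (s := s)).not.2 (not_not.2 h1)
    have e2 := (comparisonColor_eq_two (r := r) (s := s)).not.2 (not_not.2 h2)
    have e3 := (comparisonColor_eq_two (r := r) (s := s)).not.2 (not_not.2 h3)
    by_cases e : comparisonColor G r s x y = comparisonColor G r s y z
    · exact .inl e
    · rcases two e e1 e2 e3 with h | h
      · exact .inr (.inr h.symm)
      · exact .inr (.inl h.symm)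
  · exact .inl ((cm x y).trans (comparisonColor_eq_of_not_adj hr hs h1.symm h2 hxz h3))
  · exact .inr (.inr (comparisonColor_eq_of_not_adj hr hs h1 h3 hyz h2))
  · exact .inr (.inl ((comparisonColor_eq_two.2 h2).trans (comparisonColor_eq_two.2 h3).symm))
  · exact .inr (.inl ((cm y z).trans
      ((comparisonColor_eq_of_not_adj hr hs h2.symm h3.symm hxy.symm fun h => h1 h.symm).trans
        (cm z x))))
  · exact .inr (.inr ((comparisonColor_eq_two.2 h1).trans (comparisonColor_eq_two.2 h3).symm))
  all_goals exact .inl ((comparisonColor_eq_two.2 h1).trans (comparisonColor_eq_two.2 h2).symm)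

end comparison

/-- A modular-prime graph has at most one forced orientation, up to reversal. -/
theorem IsModularPrime.orientation_unique {V : Type*} [Finite V] {G : SimpleGraph V}
    (hG : IsModularPrime G) {r s : V → V → Prop} (hr : IsForcedOrientation G r)
    (hs : IsForcedOrientation G s) :
    (∀ u v, G.Adj u v → (r u v ↔ s u v)) ∨ ∀ u v, G.Adj u v → (r u v ↔ s v u) := by
  classical
  have := Fintype.ofFinite V
  by_contra! hcon
  obtain ⟨⟨x, y, hxy, h1⟩, u, v, huv, h0⟩ := hcon
  have h1' : comparisonColor G r s x y = 1 := comparisonColor_eq_one.2 ⟨hxy, by tauto⟩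
  have h0' : comparisonColor G r s u v = 0 :=
    comparisonColor_eq_zero.2 ⟨huv, by have := hs.asymm u v huv.ne; tauto⟩
  have cm := comparisonColor_comm hr hs
  have rf := rainbowFree_comparisonColor hr hs
  -- The component of `a` in the colour of `ab` is a module containing both `a` and `b`, hence
  -- everything.
  have conn : ∀ a b, a ≠ b → ∀ p q,
      ColorReach (comparisonColor G r s) .univ (comparisonColor G r s a b) p q := by
    intro a b hab
    set c := comparisonColor G r s a b
    have hb : ColorReach (comparisonColor G r s) .univ c a b :=
      .single ⟨Finset.mem_univ _, Finset.mem_univ _, rfl⟩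
    have hmod : IsGraphModule G {x | ColorReach (comparisonColor G r s) .univ c a x} := by
      intro m hm m' hm' w hw
      have e := (hm.col_eq cm rf (Finset.mem_univ w) hw).symm.trans
        (hm'.col_eq cm rf (Finset.mem_univ w) hw)
      rw [cm w m, cm w m'] at e
      rw [← not_iff_not, ← comparisonColor_eq_two (r := r) (s := s), e, comparisonColor_eq_two]
    rcases hG _ hmod with h | h | ⟨w, h⟩
    · exact absurd (show a ∈ (∅ : Set V) from h ▸ Relation.ReflTransGen.refl) (by simp)
    · have hall : ∀ p, ColorReach (comparisonColor G r s) .univ c a p := fun p =>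
        (Set.ext_iff.1 h p).2 (Set.mem_univ p)
      exact fun p q => ((hall p).symm cm).trans (hall q)
    · have e1 : a = w := (Set.ext_iff.1 h a).1 Relation.ReflTransGen.refl
      have e2 : b = w := (Set.ext_iff.1 h b).1 hb
      exact absurd (e1.trans e2.symm) hab
  by_cases hN : ∃ p q, p ≠ q ∧ ¬ G.Adj p q
  · obtain ⟨p, q, hpq, hN⟩ := hN
    have c0 := conn u v huv.ne
    have c1 := conn x y hxy.ne
    have c2 := conn p q hpq
    rw [h0'] at c0
    rw [h1'] at c1
    rw [comparisonColor_eq_two.2 hN] at c2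
    obtain ⟨c, a, -, b, -, hab⟩ := rf.exists_not_connected cm Finset.univ
      (Finset.one_lt_card.2 ⟨u, Finset.mem_univ _, v, Finset.mem_univ _, huv.ne⟩)
    fin_cases c
    · exact hab (c0 a b)
    · exact hab (c1 a b)
    · exact hab (c2 a b)
  -- In a complete graph every pair is a module, so `u` and `v` are the only vertices and the single
  -- edge would have colours 0 and 1.
  · push Not at hN
    have hmod : IsGraphModule G {u, v} := by
      intro m hm m' hm' w hw
      have e1 : m ≠ w := by rintro rfl; exact hw hm
      have e2 : m' ≠ w := by rintro rfl; exact hw hm'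
      exact ⟨fun _ => hN _ _ e2, fun _ => hN _ _ e1⟩
    have hne : comparisonColor G r s x y ≠ comparisonColor G r s u v := by
      rw [h1', h0']; decide
    rcases hG _ hmod with h | h | ⟨w, h⟩
    · exact absurd (show u ∈ (∅ : Set V) from h ▸ Set.mem_insert u _) (by simp)
    · have hx : x ∈ ({u, v} : Set V) := h ▸ Set.mem_univ x
      have hy : y ∈ ({u, v} : Set V) := h ▸ Set.mem_univ y
      rcases hx with rfl | rfl <;> rcases hy with rfl | rfl
      · exact hxy.ne rfl
      · exact hne rfl
      · exact hne (cm _ _)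
      · exact hxy.ne rfl
    · have e1 : u = w := (Set.ext_iff.1 h u).1 (by simp)
      have e2 : v = w := (Set.ext_iff.1 h v).1 (by simp)
      exact huv.ne (e1.trans e2.symm)

theorem IsModularPrime.compl {V : Type*} {G : SimpleGraph V} (hG : IsModularPrime G) :
    IsModularPrime Gᶜ := by
  intro M hM
  refine hG M fun m hm m' hm' u hu => ?_
  have h := hM m hm m' hm' u hu
  have e1 : m ≠ u := by rintro rfl; exact hu hm
  have e2 : m' ≠ u := by rintro rfl; exact hu hm'
  simp only [SimpleGraph.compl_adj, e1, e2, ne_eq, not_false_eq_true, true_and] at h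
  exact not_iff_not.1 h

/-! ### Realizers as pairs of orientations. -/

theorem inversionGraph_adj {n : ℕ} (σ : Equiv.Perm (Fin n)) (i j : Fin n) :
    (inversionGraph σ).Adj i j ↔ (i < j ∧ σ j < σ i) ∨ (j < i ∧ σ i < σ j) := by
  simp only [inversionGraph, mul_neg_iff, Fin.lt_def]
  omega

theorem inversionGraph_adj_iff {n : ℕ} (σ : Equiv.Perm (Fin n)) {i j : Fin n} (h : i ≠ j) :
    (inversionGraph σ).Adj i j ↔ (i < j ↔ σ j < σ i) := by
  rw [inversionGraph_adj]
  have h' : σ i ≠ σ j := fun e => h (σ.injective e)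
  rcases lt_or_gt_of_ne h with h1 | h1 <;> rcases lt_or_gt_of_ne h' with h2 | h2 <;>
    simp [h1, h2, h1.not_gt, h2.not_gt]

section realizer

variable {V : Type*} {G : SimpleGraph V} {n : ℕ} {τ : Equiv.Perm (Fin n)}

/-- Inversions are transitive: if `a` lies between `b` and `c` in position and is inverted with
both, then `b` and `c` are inverted. The same holds for non-inversions. -/
theorem isForcedOrientation_of_iso (φ : G ≃g inversionGraph τ) :
    IsForcedOrientation G fun u v => φ u < φ v where
  asymm u v h := by
    have : φ u ≠ φ v := fun e => h (φ.injective e)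
    rw [not_lt]; exact ⟨le_of_lt, fun h => lt_of_le_of_ne h this⟩
  forced a b c hab hac hbc h := by
    rw [← φ.map_adj_iff, inversionGraph_adj] at hab hac h
    constructor <;> intro _ <;> grind

theorem isForcedOrientation_compl_of_iso (φ : G ≃g inversionGraph τ) :
    IsForcedOrientation Gᶜ fun u v => φ u < φ v where
  asymm := (isForcedOrientation_of_iso φ).asymm
  forced a b c hab hac hbc h := by
    rw [SimpleGraph.compl_adj, ← φ.map_adj_iff] at hab hac h
    have h1 : φ a ≠ φ b := fun e => hab.1 (φ.injective e)
    have h2 : φ a ≠ φ c := fun e => hac.1 (φ.injective e)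
    have h3 : φ b ≠ φ c := fun e => hbc (φ.injective e)
    have i1 := τ.injective.ne h1
    have i2 := τ.injective.ne h2
    have i3 := τ.injective.ne h3
    rw [inversionGraph_adj] at hab hac h
    constructor <;> intro _ <;> grind

theorem image_lt_iff_of_iso (φ : G ≃g inversionGraph τ) {u v : V} (h : u ≠ v) :
    τ (φ v) < τ (φ u) ↔ (G.Adj u v ↔ φ u < φ v) := by
  rw [← φ.map_adj_iff, inversionGraph_adj_iff τ fun e => h (φ.injective e)]
  tauto

/-- A realizer is determined by the order of the positions of the vertices. -/
theorem realizer_eq_of_lt_iff {m : ℕ} {τ' : Equiv.Perm (Fin m)} (φ : G ≃g inversionGraph τ)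
    (ψ : G ≃g inversionGraph τ') (h : ∀ u v, u ≠ v → (φ u < φ v ↔ ψ u < ψ v)) :
    (⟨n, τ⟩ : Σ n : ℕ, Equiv.Perm (Fin n)) = ⟨m, τ'⟩ := by
  obtain rfl : n = m := by
    simpa using Fintype.card_congr (φ.symm.toEquiv.trans ψ.toEquiv)
  -- `Fin n` has no nontrivial order automorphism. This is used for positions, then for values,
  -- whose order follows from positions and adjacency.
  have unique : ∀ f g : V ≃ Fin n, (∀ u v, u ≠ v → (f u < f v ↔ g u < g v)) → f = g := by
    intro f g hfg
    have hm : StrictMono (f.symm.trans g) := by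
      intro i j hij
      have hne : f.symm i ≠ f.symm j := f.symm.injective.ne hij.ne
      simpa using (hfg _ _ hne).1 (by simpa using hij)
    have he : hm.orderIsoOfSurjective _ (Equiv.surjective _) = OrderIso.refl (Fin n) :=
      Subsingleton.elim _ _
    ext u
    have := DFunLike.congr_fun he (f u)
    simp at this
    rw [this]
  have e1 : ∀ u, φ u = ψ u := fun u => DFunLike.congr_fun (unique φ.toEquiv ψ.toEquiv h) u
  have e2 := unique (φ.toEquiv.trans τ) (ψ.toEquiv.trans τ') fun u v huv => by
    have a := image_lt_iff_of_iso φ huv.symm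
    have b := image_lt_iff_of_iso ψ huv.symm
    have c := h v u huv.symm
    change τ (φ u) < τ (φ v) ↔ τ' (ψ u) < τ' (ψ v)
    rw [a, b, c]
  have : τ = τ' := by
    ext i
    have h1 := DFunLike.congr_fun e2 (φ.symm i)
    have h2 := e1 (φ.symm i)
    simp only [RelIso.apply_symm_apply] at h2
    change τ (φ (φ.symm i)) = τ' (ψ (φ.symm i)) at h1
    rw [← h2, RelIso.apply_symm_apply] at h1
    rw [h1]
  rw [this]

end realizer

/-! ### Intervals are modules; the main theorem. -/

theorem Set.OrdConnected.lt_iff_lt {α : Type*} [LinearOrder α] {I : Set α} (hI : I.OrdConnected)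
    {a b u : α} (ha : a ∈ I) (hb : b ∈ I) (hu : u ∉ I) : a < u ↔ b < u := by
  constructor <;> intro h <;> by_contra! h'
  · exact hu (hI.out ha hb ⟨h.le, h'⟩)
  · exact hu (hI.out hb ha ⟨h.le, h'⟩)

/-- A point outside an interval lies on one side of it both in position and in value, so it is
inverted with all its elements or with none. -/
theorem IsPermInterval.isGraphModule {n : ℕ} {σ : Equiv.Perm (Fin n)} {I : Set (Fin n)}
    (h : IsPermInterval σ I) : IsGraphModule (inversionGraph σ) I := by
  intro m hm m' hm' u hu
  have h1 : m ≠ u := by rintro rfl; exact hu hm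
  have h2 : m' ≠ u := by rintro rfl; exact hu hm'
  have hu' : σ u ∉ σ '' I := by rwa [σ.injective.mem_set_image]
  have e1 := h.1.lt_iff_lt hm hm' hu
  have e2 := h.2.lt_iff_lt (Set.mem_image_of_mem σ hm) (Set.mem_image_of_mem σ hm') hu'
  have n1 := σ.injective.ne h1
  have n2 := σ.injective.ne h2
  rw [inversionGraph_adj_iff σ h1, inversionGraph_adj_iff σ h2, e1]
  have e3 : σ u < σ m ↔ σ u < σ m' := by grind
  rw [e3]

theorem IsModularPrime.of_iso {V W : Type*} {G : SimpleGraph V} {H : SimpleGraph W}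
    (hG : IsModularPrime G) (φ : G ≃g H) : IsModularPrime H := by
  intro M hM
  have hmod : IsGraphModule G (φ ⁻¹' M) := fun m hm m' hm' u hu => by
    rw [← φ.map_adj_iff, ← φ.map_adj_iff]
    exact hM _ hm _ hm' _ hu
  have him : φ '' (φ ⁻¹' M) = M := Set.image_preimage_eq M φ.surjective
  rcases hG _ hmod with h | h | ⟨v, h⟩ <;> rw [h] at him
  · exact .inl (by simpa using him.symm)
  · exact .inr (.inl (by rw [← him, Set.image_univ, φ.surjective.range_eq]))
  · exact .inr (.inr ⟨φ v, by simpa using him.symm⟩)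

theorem mainTheorem10 {V : Type*} (G : SimpleGraph V)
    (hperm : IsPermutationGraph G) (hprime : IsModularPrime G) :
    {τ : Σ n : ℕ, Equiv.Perm (Fin n) | Realizes τ.2 G}.encard ≤ 4 ∧
      ∀ (n : ℕ) (τ : Equiv.Perm (Fin n)), Realizes τ G → IsSimplePerm τ := by
  classical
  refine ⟨?_, fun n τ ⟨φ⟩ I hI => hprime.of_iso φ I hI.isGraphModule⟩
  obtain ⟨n₀, σ, ⟨φ₀⟩⟩ := hperm
  have : Finite V := Finite.of_equiv _ φ₀.symm.toEquiv
  let S := {τ : Σ n : ℕ, Equiv.Perm (Fin n) | Realizes τ.2 G}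
  let iso (τ : S) : G ≃g inversionGraph τ.1.2 := τ.2.some
  let same (τ : S) (H : SimpleGraph V) : Prop :=
    ∀ u v, H.Adj u v → (iso τ u < iso τ v ↔ φ₀ u < φ₀ v)
  -- The bits record whether the order agrees with the reference `φ₀` on edges and on non-edges; by
  -- uniqueness, failing to agree means being reversed throughout.
  let code (τ : S) : Bool × Bool := (decide (same τ G), decide (same τ Gᶜ))
  have hrec : ∀ (τ τ' : S) (H : SimpleGraph V), IsModularPrime H →
      (∀ τ : S, IsForcedOrientation H fun u v => iso τ u < iso τ v) →
      IsForcedOrientation H (fun u v => φ₀ u < φ₀ v) → (same τ H ↔ same τ' H) →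
      ∀ u v, H.Adj u v → (iso τ u < iso τ v ↔ iso τ' u < iso τ' v) := by
    intro τ τ' H hH h h₀ hiff u v huv
    by_cases hs : same τ H
    · rw [hs u v huv, (hiff.1 hs) u v huv]
    · have h1 := (hH.orientation_unique (h τ) h₀).resolve_left hs
      have h2 := (hH.orientation_unique (h τ') h₀).resolve_left fun h => hs (hiff.2 h)
      rw [h1 u v huv, h2 u v huv]
  have hinj : Function.Injective code := by
    intro τ τ' h
    have e1 : same τ G ↔ same τ' G := decide_eq_decide.1 (congrArg Prod.fst h)
    have e2 : same τ Gᶜ ↔ same τ' Gᶜ := decide_eq_decide.1 (congrArg Prod.snd h)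
    have h1 := hrec τ τ' G hprime (fun τ => isForcedOrientation_of_iso (iso τ))
      (isForcedOrientation_of_iso φ₀) e1
    have h2 := hrec τ τ' Gᶜ hprime.compl (fun τ => isForcedOrientation_compl_of_iso (iso τ))
      (isForcedOrientation_compl_of_iso φ₀) e2
    apply Subtype.ext
    refine realizer_eq_of_lt_iff (iso τ) (iso τ') fun u v huv => ?_
    by_cases hadj : G.Adj u v
    · exact h1 u v hadj
    · exact h2 u v ((SimpleGraph.compl_adj _ _ _).2 ⟨huv, hadj⟩)
  calc S.encard = ENat.card S := rfl
    _ ≤ ENat.card (Bool × Bool) := ENat.card_le_card_of_injective hinj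
    _ = 4 := by simp [ENat.card_eq_coe_fintype_card]
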